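/- All graphs are finite, undirected and simple, with nodes taken from the natural numbers. An incremental graph sequence of length $T$ with edge weights in $\{1,\dots,W\}$ consists of an initial weighted graph $G_0$ (possibly non-empty) and graphs $G_1,\dots,G_T$, where $G_t$ arises from $G_{t-1}$ by inserting a finite set of new nodes and a finite set of new weighted edges; nothing is deleted and weights never change. Two such sequences (of the same length, with the same initial graph) are - *edge-adjacent* if at each time step the same nodes are inserted into both, and the edge insertions are the same except that a single edge $e^*$ is inserted at one time $t^*$ in one of the two sequences and never in the other; - *node-adjacent* if the node insertions are the same except that a single node $v^*$ is inserted at one time $t^*$ in one of the two sequences, $\mathcal G$, and not in the other, $\mathcal G'$; every edge inserted into $\mathcal G$ at a time $t$ is incident to a node inserted at time $t$; and the edges inserted into $\mathcal G'$ at time $t$ are exactly those inserted into $\mathcal G$ at time $t$ that are not incident to $v^*$. A randomized algorithm $\mathcal A$ maps each such sequence $\mathcal G$ to a random vector $\mathcal A(\mathcal G)\in\mathbb R^T$, whose $t$-th entry is the answer released at time $t$. It is $\varepsilon$-edge-differentially private (resp. $\varepsilon$-node-differentially private) if $\Pr[\mathcal A(\mathcal G)\in S]\le e^{\varepsilon}\,\Pr[\mathcal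 A(\mathcal G')\in S]$ for all edge-adjacent (resp. node-adjacent) $\mathcal G,\mathcal G'$, in either order, and all measurable $S\subseteq\mathbb R^T$. For a graph $G=(V,E,w)$ with $|V|\ge 2$, let $w_{\mathrm{CUT}}(G)$ be the minimum over all $\emptyset\ne S\subsetneq V$ of the total weight of the edges between $S$ and $V\setminus S$. **Theorem.** For every $\varepsilon>0$ (in particular for $\varepsilon=1$) there is a constant $c>0$ such that for every $\beta<1$ there is a $T_0$ such that for all $T\ge T_0$ and all integers $W\ge 1$ the following holds. For every $\varepsilon$-edge-differentially private algorithm $\mathcal A$ on incremental graph sequences of length $T$ with edge weights in $\{1,\dots,W\}$ there is such a sequence $\mathcal G$, all of whose graphs have at least two nodes, with $$\Pr\Big[\max_{1\le t\le T}\big|\mathcal A(\mathcal G)_t-w_{\mathrm{CUT}}(G_t)\big|\ \ge\ c\,W\log T\Big]>\beta .$$ The same statement holds for $\varepsilon$-node-differentially private algorithms. That is, any $\varepsilon$-edge-differentially private and any $\varepsilon$-node-differentially private algorithm to compute the weight of a minimum cut in incremental graph sequences of length $T$ with edge weights in $\{1,\dots,W\}$ must have additive error $\Omega(W\log T)$.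 -/

import Mathlib

namespace MinCutDP

/-- A finite, undirected, loopless graph with positive integer edge weights; its nodes are
natural numbers.  The edges are the pairs of nonzero weight, that is, the support of `weight`. -/
structure WGraph where
  verts : Finset ℕ
  weight : Sym2 ℕ →₀ ℕ
  loopless : ∀ e ∈ weight.support, ¬ e.IsDiag
  incident : ∀ e ∈ weight.support, ∀ v ∈ e, v ∈ verts

/-- The set of edges, each together with its weight. -/
def WGraph.edges (G : WGraph) : Finset (Sym2 ℕ × ℕ) := G.weight.graph

/-- The weight of the cut `(S, V \ S)`: every edge between the two sides is counted once. -/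
def WGraph.cutWeight (G : WGraph) (S : Finset ℕ) : ℕ :=
  ∑ u ∈ S, ∑ v ∈ G.verts \ S, G.weight s(u, v)

/-- The weight of a (global) minimum cut: the least weight of a cut `(S, V \ S)` with both sides
nonempty.  It is meaningful for graphs with at least two nodes (otherwise there is no cut, and the
value is `0` by convention). -/
noncomputable def WGraph.minCut (G : WGraph) : ℕ :=
  sInf {c : ℕ | ∃ S : Finset ℕ, S.Nonempty ∧ S ⊂ G.verts ∧ G.cutWeight S = c}

/-- An incremental graph sequence `G₁, …, G_T` with initial graph `G₀` and edge weights in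
`{1, …, W}`: nodes and edges are inserted, never deleted, and a weight never changes. -/
structure IncSeq (T W : ℕ) where
  graph : Fin (T + 1) → WGraph
  verts_mono : ∀ t : Fin T, (graph t.castSucc).verts ⊆ (graph t.succ).verts
  edges_mono : ∀ t : Fin T, (graph t.castSucc).edges ⊆ (graph t.succ).edges
  weight_le : ∀ (t : Fin (T + 1)) (e : Sym2 ℕ), (graph t).weight e ≤ W

variable {T W : ℕ}

/-- The set of nodes inserted at the time step that leads from `G_t` to `G_{t+1}`. -/
def IncSeq.insVerts (𝒢 : IncSeq T W) (t : Fin T) : Finset ℕ :=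
  (𝒢.graph t.succ).verts \ (𝒢.graph t.castSucc).verts

/-- The set of (weighted) edges inserted at the time step that leads from `G_t` to `G_{t+1}`. -/
def IncSeq.insEdges (𝒢 : IncSeq T W) (t : Fin T) : Finset (Sym2 ℕ × ℕ) :=
  (𝒢.graph t.succ).edges \ (𝒢.graph t.castSucc).edges

/-- Event-level edge-adjacency of incremental sequences, in the direction in which `𝒢` has the
additional edge insertion: the sequences have the same initial graph and the same node insertions,
and their edge insertions differ only in that one edge `e` is inserted at one time in `𝒢` and is
not inserted in `𝒢'`. -/
def EdgeAdj (𝒢 𝒢' : IncSeq T W) : Prop :=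
  𝒢.graph 0 = 𝒢'.graph 0 ∧
  (∀ t, 𝒢.insVerts t = 𝒢'.insVerts t) ∧
  ∃ (e : Sym2 ℕ × ℕ) (s : Fin T),
    𝒢'.insEdges s ⊆ 𝒢.insEdges s ∧
    𝒢.insEdges s \ 𝒢'.insEdges s = {e} ∧
    ∀ t, t ≠ s → 𝒢.insEdges t = 𝒢'.insEdges t

/-- Event-level node-adjacency of incremental sequences, in the direction in which `𝒢` has the
additional node insertion: the sequences have the same initial graph, the node insertions differ
only in that one node `v` is inserted at one time in `𝒢` and not in `𝒢'`, every edge is inserted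
together with one of its end nodes, and the edge insertions of `𝒢'` are those of `𝒢` that are not
incident to `v`. -/
def NodeAdj (𝒢 𝒢' : IncSeq T W) : Prop :=
  𝒢.graph 0 = 𝒢'.graph 0 ∧
  ∃ (v : ℕ) (s : Fin T),
    𝒢'.insVerts s ⊆ 𝒢.insVerts s ∧
    𝒢.insVerts s \ 𝒢'.insVerts s = {v} ∧
    (∀ t, t ≠ s → 𝒢.insVerts t = 𝒢'.insVerts t) ∧
    (∀ t, ∀ e ∈ 𝒢.insEdges t, ∃ u ∈ e.1, u ∈ 𝒢.insVerts t) ∧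
    ∀ t, ∀ e, e ∈ 𝒢'.insEdges t ↔ e ∈ 𝒢.insEdges t ∧ v ∉ e.1

/-- A randomized algorithm that releases one real number at each of the time steps `1, …, T`,
given by the law of its output sequence on each input.  Coordinate `t : Fin T` is the output at
time `t + 1`.  The output at a time may depend on the whole input sequence. -/
abbrev Mechanism (T W : ℕ) : Type :=
  IncSeq T W → MeasureTheory.ProbabilityMeasure (Fin T → ℝ)

/-- `ε`-differential privacy with respect to (the symmetric closure of) an adjacency relation. -/
def IsDP (adj : IncSeq T W → IncSeq T W → Prop) (ε : ℝ) (A : Mechanism T W) : Prop :=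
  ∀ 𝒢 𝒢' : IncSeq T W, adj 𝒢 𝒢' ∨ adj 𝒢' 𝒢 →
    ∀ S : Set (Fin T → ℝ), MeasurableSet S →
      (A 𝒢 : MeasureTheory.Measure (Fin T → ℝ)) S
        ≤ ENNReal.ofReal (Real.exp ε) * (A 𝒢' : MeasureTheory.Measure (Fin T → ℝ)) S

/-- `ε`-edge-differential privacy (on event-level). -/
def EdgeDP (ε : ℝ) (A : Mechanism T W) : Prop := IsDP EdgeAdj ε A

/-- `ε`-node-differential privacy (on event-level). -/
def NodeDP (ε : ℝ) (A : Mechanism T W) : Prop := IsDP NodeAdj ε A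

/-- The output sequences `x` for `𝒢` whose additive error with respect to the weights of the
minimum cuts of `G₁, …, G_T` is at least `α` at some time step. -/
def errorEvent (𝒢 : IncSeq T W) (α : ℝ) : Set (Fin T → ℝ) :=
  {x | ∃ t : Fin T, α ≤ |x t - ((𝒢.graph t.succ).minCut : ℝ)|}

end MinCutDP

namespace MinCutDP

open MeasureTheory

/-! ### Graphs all of whose edges have the same weight -/

/-! The lower bound is a packing argument. Take `T` sequences that differ only in the time at which
one change is made, where the change moves the minimum cut by at least `W * n`. For `2 * α ≤ W * n`,
the sets of outputs with error below `α` are pairwise disjoint. If each sequence is reached from one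
constant sequence by `k` adjacency steps and each accurate set had probability at least `1 - β` on
its own input, each would have probability at least `exp (-ε * k) * (1 - β)` on the constant
sequence. Summing over `T` disjoint sets gives `T * (1 - β) ≤ exp (ε * k)`, which is false for large
`T`.

For edges, an isolated node is joined to all of an `n`-clique in one time step: the minimum cut
rises from `0` to at least `W * n`, and `k = n` is taken of order `log T / ε`. For nodes, an
isolated node is added to an `(n + 1)`-clique: the minimum cut falls from at least `W * n` to `0`,
with `k = 1`. -/

/-- The graph with node set `V` in which every non-loop of `E` inside `V` is an edge of
weight `W`. -/
noncomputable def uniformGraph (W : ℕ) (V : Finset ℕ) (E : Finset (Sym2 ℕ)) : WGraph where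
  verts := V
  weight := Finsupp.indicator {e ∈ V.sym2 | ¬ e.IsDiag ∧ e ∈ E} fun _ _ => W
  loopless _ he := (Finset.mem_filter.1 (Finsupp.support_indicator_subset _ _ he)).2.1
  incident _ he :=
    Finset.mem_sym2_iff.1 (Finset.mem_filter.1 (Finsupp.support_indicator_subset _ _ he)).1

theorem uniformGraph_weight (W : ℕ) (V : Finset ℕ) (E : Finset (Sym2 ℕ)) (e : Sym2 ℕ) :
    (uniformGraph W V E).weight e = if e ∈ V.sym2 ∧ ¬ e.IsDiag ∧ e ∈ E then W else 0 := by
  simp only [uniformGraph, Finsupp.indicator_apply, dite_eq_ite]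
  exact if_congr Finset.mem_filter rfl rfl

theorem uniformGraph_weight_le (W : ℕ) (V : Finset ℕ) (E : Finset (Sym2 ℕ)) (e : Sym2 ℕ) :
    (uniformGraph W V E).weight e ≤ W := by
  rw [uniformGraph_weight]
  split_ifs <;> simp

theorem mem_edges_uniformGraph {W : ℕ} {V : Finset ℕ} {E : Finset (Sym2 ℕ)} {p : Sym2 ℕ × ℕ} :
    p ∈ (uniformGraph W V E).edges ↔
      (p.1 ∈ V.sym2 ∧ ¬ p.1.IsDiag ∧ p.1 ∈ E) ∧ p.2 = W ∧ W ≠ 0 := by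
  rw [WGraph.edges, Finsupp.mem_graph_iff, uniformGraph_weight]
  split_ifs with h
  · simp only [h, true_and, not_false_eq_true]
    constructor
    · rintro ⟨h₁, h₂⟩
      exact ⟨h₁.symm, h₁ ▸ h₂⟩
    · rintro ⟨h₁, h₂⟩
      exact ⟨h₁.symm, h₁ ▸ h₂⟩
  · simp only [h, false_and, iff_false, not_and, not_not]
    exact fun h => h.symm

theorem edges_uniformGraph_mono (W : ℕ) {V V' : Finset ℕ} {E E' : Finset (Sym2 ℕ)}
    (hV : V ⊆ V') (hE : E ⊆ E') :
    (uniformGraph W V E).edges ⊆ (uniformGraph W V' E').edges := by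
  intro p hp
  rw [mem_edges_uniformGraph] at hp ⊢
  exact ⟨⟨Finset.sym2_mono hV hp.1.1, hp.1.2.1, hE hp.1.2.2⟩, hp.2⟩

theorem edges_uniformGraph_insert {W : ℕ} (hW : 1 ≤ W) {V : Finset ℕ} {E : Finset (Sym2 ℕ)}
    {e : Sym2 ℕ} (hV : e ∈ V.sym2) (hd : ¬ e.IsDiag) :
    (uniformGraph W V (insert e E)).edges = insert (e, W) (uniformGraph W V E).edges := by
  ext ⟨f, w⟩
  simp only [mem_edges_uniformGraph, Finset.mem_insert, Prod.mk.injEq]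
  constructor
  · rintro ⟨⟨h₁, h₂, rfl | h₃⟩, rfl, h₄⟩
    · exact Or.inl ⟨rfl, rfl⟩
    · exact Or.inr ⟨⟨h₁, h₂, h₃⟩, rfl, h₄⟩
  · rintro (⟨rfl, rfl⟩ | ⟨⟨h₁, h₂, h₃⟩, rfl, h₄⟩)
    · exact ⟨⟨hV, hd, Or.inl rfl⟩, rfl, by omega⟩
    · exact ⟨⟨h₁, h₂, Or.inr h₃⟩, rfl, h₄⟩

/-! ### Minimum cuts of complete graphs and of graphs with an isolated node -/

theorem WGraph.minCut_eq_zero_of_isolated (G : WGraph) {v : ℕ} (hv : v ∈ G.verts)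
    (hcard : 2 ≤ G.verts.card) (h : ∀ u, G.weight s(v, u) = 0) : G.minCut = 0 := by
  refine Nat.sInf_eq_zero.2 (Or.inl ⟨{v}, Finset.singleton_nonempty v, ?_, ?_⟩)
  · refine Finset.ssubset_iff_subset_ne.2 ⟨Finset.singleton_subset_iff.2 hv, ?_⟩
    intro hs
    rw [← hs, Finset.card_singleton] at hcard
    omega
  · simp [WGraph.cutWeight, h]

/-- A cut with sides of sizes `a + 1` and `b + 1` has weight `(a + 1) * (b + 1) * W`, which exceeds
`(a + b + 1) * W` by `a * b * W`. -/
theorem WGraph.le_minCut_of_complete (G : WGraph) {W n : ℕ} (hn : 1 ≤ n)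
    (hcard : G.verts.card = n + 1)
    (h : ∀ u ∈ G.verts, ∀ v ∈ G.verts, u ≠ v → G.weight s(u, v) = W) :
    W * n ≤ G.minCut := by
  -- Existence of a cut has to be checked, since the infimum of the empty set in `ℕ` is `0`.
  refine le_csInf ?_ ?_
  · obtain ⟨v, hv⟩ : G.verts.Nonempty := Finset.card_pos.1 (by omega)
    refine ⟨_, {v}, Finset.singleton_nonempty v, ?_, rfl⟩
    refine Finset.ssubset_iff_subset_ne.2 ⟨Finset.singleton_subset_iff.2 hv, ?_⟩
    intro hs
    rw [← hs, Finset.card_singleton] at hcard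
    omega
  · rintro c ⟨S, hS, hSV, rfl⟩
    have hcut : G.cutWeight S = S.card * ((G.verts \ S).card * W) := by
      rw [WGraph.cutWeight, ← smul_eq_mul, ← smul_eq_mul]
      refine Finset.sum_eq_card_nsmul fun u hu => Finset.sum_eq_card_nsmul fun v hv => ?_
      rw [Finset.mem_sdiff] at hv
      exact h u (hSV.subset hu) v hv.1 fun huv => hv.2 (huv ▸ hu)
    have hlt := Finset.card_lt_card hSV
    have hpos := hS.card_pos
    have hsum := Finset.card_sdiff_add_card_eq_card hSV.subset
    rw [hcut]
    obtain ⟨a, ha⟩ : ∃ a, S.card = a + 1 := ⟨S.card - 1, by omega⟩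
    obtain ⟨b, hb⟩ : ∃ b, (G.verts \ S).card = b + 1 := ⟨(G.verts \ S).card - 1, by omega⟩
    have hnab : n = a + b + 1 := by omega
    rw [ha, hb, hnab]
    calc W * (a + b + 1) ≤ W * (a + b + 1) + W * (a * b) := Nat.le_add_right _ _
      _ = (a + 1) * ((b + 1) * W) := by ring

/-! ### Sequences with a single insertion time -/

/-- The sequence that is constantly `G` until, at the time step from `G_i` to `G_{i+1}`, it
becomes `H`. -/
def stepSeq {T W : ℕ} (G H : WGraph) (hV : G.verts ⊆ H.verts) (hE : G.edges ⊆ H.edges)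
    (hG : ∀ e, G.weight e ≤ W) (hH : ∀ e, H.weight e ≤ W) (i : Fin T) : IncSeq T W where
  -- The graph at index `i` is still `G`; the output coordinate `i` refers to index `i + 1` and
  -- already sees `H`.
  graph t := if t ≤ i.castSucc then G else H
  verts_mono t := by
    by_cases h₁ : t.succ ≤ i.castSucc
    · rw [if_pos h₁, if_pos ((Fin.castSucc_le_succ t).trans h₁)]
    · rw [if_neg h₁]
      split_ifs
      exacts [hV, subset_rfl]
  edges_mono t := by
    by_cases h₁ : t.succ ≤ i.castSucc
    · rw [if_pos h₁, if_pos ((Fin.castSucc_le_succ t).trans h₁)]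
    · rw [if_neg h₁]
      split_ifs
      exacts [hE, subset_rfl]
  weight_le t e := by
    split_ifs
    exacts [hG e, hH e]

section StepSeq

variable {T W : ℕ} {G H : WGraph} {hV : G.verts ⊆ H.verts} {hE : G.edges ⊆ H.edges}
  {hG : ∀ e, G.weight e ≤ W} {hH : ∀ e, H.weight e ≤ W} {i : Fin T}

theorem stepSeq_graph_zero : (stepSeq G H hV hE hG hH i).graph 0 = G :=
  if_pos (e := H) (Fin.zero_le i.castSucc)

theorem stepSeq_graph_succ (t : Fin T) :
    (stepSeq G H hV hE hG hH i).graph t.succ = if t < i then G else H := by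
  simp only [stepSeq, Fin.succ_le_castSucc_iff]

theorem stepSeq_graph_castSucc (t : Fin T) :
    (stepSeq G H hV hE hG hH i).graph t.castSucc = if t ≤ i then G else H := by
  simp only [stepSeq, Fin.castSucc_le_castSucc_iff]

theorem stepSeq_insVerts (t : Fin T) :
    (stepSeq G H hV hE hG hH i).insVerts t = if t = i then H.verts \ G.verts else ∅ := by
  rw [IncSeq.insVerts, stepSeq_graph_succ, stepSeq_graph_castSucc]
  rcases lt_trichotomy t i with h | rfl | h
  · simp [h, h.le, h.ne]
  · simp
  · simp [h.not_gt, h.not_ge, h.ne']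

theorem stepSeq_insEdges (t : Fin T) :
    (stepSeq G H hV hE hG hH i).insEdges t = if t = i then H.edges \ G.edges else ∅ := by
  rw [IncSeq.insEdges, stepSeq_graph_succ, stepSeq_graph_castSucc]
  rcases lt_trichotomy t i with h | rfl | h
  · simp [h, h.le, h.ne]
  · simp
  · simp [h.not_gt, h.not_ge, h.ne']

/-- If no change happens, the time of the change is irrelevant. -/
theorem stepSeq_self (i j : Fin T) (hV : G.verts ⊆ G.verts) (hE : G.edges ⊆ G.edges)
    (hG : ∀ e, G.weight e ≤ W) :
    stepSeq G G hV hE hG hG i = stepSeq G G hV hE hG hG j := by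
  simp [stepSeq]

theorem edgeAdj_stepSeq {H' : WGraph} {hV' : G.verts ⊆ H'.verts} {hE' : G.edges ⊆ H'.edges}
    {hH' : ∀ e, H'.weight e ≤ W} {e : Sym2 ℕ × ℕ} (hverts : H'.verts = H.verts)
    (hedges : H'.edges = insert e H.edges) (he : e ∉ H.edges) :
    EdgeAdj (stepSeq G H' hV' hE' hG hH' i) (stepSeq G H hV hE hG hH i) := by
  refine ⟨by rw [stepSeq_graph_zero, stepSeq_graph_zero], fun t => ?_, e, i, ?_, ?_, ?_⟩
  · rw [stepSeq_insVerts, stepSeq_insVerts, hverts]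
  · simp only [stepSeq_insEdges, if_true, hedges]
    exact Finset.sdiff_subset_sdiff (Finset.subset_insert _ _) subset_rfl
  · simp only [stepSeq_insEdges, if_true, hedges]
    ext f
    -- The edge is absent from the initial graph, so it counts as an insertion at time `i`.
    have hGe : e ∉ G.edges := fun h => he (hE h)
    simp only [Finset.mem_sdiff, Finset.mem_insert, Finset.mem_singleton]
    constructor
    · rintro ⟨⟨rfl | h₁, h₂⟩, h₃⟩
      · rfl
      · exact absurd ⟨h₁, h₂⟩ h₃
    · rintro rfl
      exact ⟨⟨Or.inl rfl, hGe⟩, fun h => he h.1⟩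
  · intro t ht
    rw [stepSeq_insEdges, stepSeq_insEdges, if_neg ht, if_neg ht]

/-- Inserting an isolated node is node-adjacent to inserting nothing. -/
theorem nodeAdj_stepSeq {v : ℕ} {hV₀ : G.verts ⊆ G.verts} {hE₀ : G.edges ⊆ G.edges}
    (hverts : H.verts = insert v G.verts) (hv : v ∉ G.verts) (hedges : H.edges = G.edges) :
    NodeAdj (stepSeq G H hV hE hG hH i) (stepSeq G G hV₀ hE₀ hG hG i) := by
  have hdiff : H.verts \ G.verts = {v} := by
    rw [hverts, Finset.insert_sdiff_of_notMem _ hv, Finset.sdiff_self, insert_empty_eq]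
  refine ⟨by rw [stepSeq_graph_zero, stepSeq_graph_zero], v, i, ?_, ?_, ?_, ?_, ?_⟩
  · simp [stepSeq_insVerts]
  · simp [stepSeq_insVerts, hdiff]
  · intro t ht
    simp [stepSeq_insVerts, ht]
  -- No edge is ever inserted, so both conditions on edge insertions are vacuous.
  · intro t e he
    simp [stepSeq_insEdges, hedges] at he
  · intro t e
    simp [stepSeq_insEdges, hedges]

/-- If the minimum cuts of the two graphs are at least `2α` apart, then so are the minimum cuts
of two sequences with different insertion times, at some time. -/
theorem exists_minCut_separated {α : ℝ}
    (hα : 2 * α ≤ |(G.minCut : ℝ) - (H.minCut : ℝ)|) {i j : Fin T} (hij : i ≠ j) :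
    ∃ t : Fin T, 2 * α ≤ |(((stepSeq G H hV hE hG hH i).graph t.succ).minCut : ℝ) -
      (((stepSeq G H hV hE hG hH j).graph t.succ).minCut : ℝ)| := by
  rcases lt_or_gt_of_ne hij with h | h
  -- The earlier change time separates the two: one sequence has already changed, the other has not.
  · refine ⟨i, ?_⟩
    rw [stepSeq_graph_succ, stepSeq_graph_succ, if_neg (lt_irrefl i), if_pos h, abs_sub_comm]
    exact hα
  · refine ⟨j, ?_⟩
    rw [stepSeq_graph_succ, stepSeq_graph_succ, if_neg (lt_irrefl j), if_pos h]
    exact hα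

end StepSeq

/-! ### The packing argument -/

theorem measurableSet_errorEvent {T W : ℕ} (𝒢 : IncSeq T W) (α : ℝ) :
    MeasurableSet (errorEvent 𝒢 α) := by
  have h : errorEvent 𝒢 α =
      ⋃ t : Fin T, {x | α ≤ |x t - ((𝒢.graph t.succ).minCut : ℝ)|} := by
    ext x
    simp [errorEvent]
  rw [h]
  refine MeasurableSet.iUnion fun t => measurableSet_le measurable_const ?_
  exact ((measurable_pi_apply t).sub_const _).abs

/-- By the triangle inequality, no output at the separating time is within less than `α` of both
minimum cuts. -/
theorem disjoint_compl_errorEvent {T W : ℕ} {𝒢 𝒢' : IncSeq T W} {α : ℝ}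
    (h : ∃ t : Fin T, 2 * α ≤
      |((𝒢.graph t.succ).minCut : ℝ) - ((𝒢'.graph t.succ).minCut : ℝ)|) :
    Disjoint (errorEvent 𝒢 α)ᶜ (errorEvent 𝒢' α)ᶜ := by
  rw [Set.disjoint_left]
  intro x hx hx'
  obtain ⟨t, ht⟩ := h
  simp only [errorEvent, Set.mem_compl_iff, Set.mem_ofPred_eq, not_exists, not_le] at hx hx'
  have htri := abs_sub_le ((𝒢.graph t.succ).minCut : ℝ) (x t) ((𝒢'.graph t.succ).minCut : ℝ)
  rw [abs_sub_comm ((𝒢.graph t.succ).minCut : ℝ) (x t)] at htri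
  linarith [hx t, hx' t]

/-- If `T` sequences have pairwise separated minimum cuts, and the output law on each of them is
at most `K` times the output law on a fixed sequence, then the error is large on one of them. -/
theorem exists_errorEvent_of_packing {T W : ℕ} (A : Mechanism T W) (𝒢₀ : IncSeq T W)
    (𝒢 : Fin T → IncSeq T W) {K α β : ℝ} (hK : 0 ≤ K)
    (hdom : ∀ i, ∀ S : Set (Fin T → ℝ), MeasurableSet S →
      (A (𝒢 i) : Measure (Fin T → ℝ)) S ≤ ENNReal.ofReal K * (A 𝒢₀ : Measure (Fin T → ℝ)) S)
    (hsep : ∀ i j, i ≠ j → ∃ t : Fin T, 2 * α ≤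
      |(((𝒢 i).graph t.succ).minCut : ℝ) - (((𝒢 j).graph t.succ).minCut : ℝ)|)
    (hKT : K < T * (1 - β)) :
    ∃ i, β < (A (𝒢 i) : Measure (Fin T → ℝ)).real (errorEvent (𝒢 i) α) := by
  by_contra! hcon
  set P : Measure (Fin T → ℝ) := (A 𝒢₀ : Measure (Fin T → ℝ)) with hP
  -- If every sequence had small error, each accurate set would have mass at least `(1 - β) / K`
  -- under the single law `P`.
  have hreal : ∀ i, 1 - β ≤ K * P.real (errorEvent (𝒢 i) α)ᶜ := by
    intro i
    have hm := measurableSet_errorEvent (𝒢 i) α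
    have h₁ : (A (𝒢 i) : Measure (Fin T → ℝ)).real (errorEvent (𝒢 i) α)ᶜ ≤
        K * P.real (errorEvent (𝒢 i) α)ᶜ := by
      have := ENNReal.toReal_mono
        (ENNReal.mul_ne_top ENNReal.ofReal_ne_top (measure_ne_top P _)) (hdom i _ hm.compl)
      rwa [ENNReal.toReal_mul, ENNReal.toReal_ofReal hK] at this
    rw [probReal_compl_eq_one_sub hm] at h₁
    linarith [hcon i]
  have hunion : ∑ i, P.real (errorEvent (𝒢 i) α)ᶜ ≤ 1 := by
    rw [← measureReal_iUnion_fintype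
      (fun i j hij => disjoint_compl_errorEvent (hsep i j hij))
      (fun i => (measurableSet_errorEvent (𝒢 i) α).compl)]
    exact measureReal_le_one
  have hsum := Finset.sum_le_sum fun i (_ : i ∈ Finset.univ) => hreal i
  rw [← Finset.mul_sum, Finset.sum_const, Finset.card_univ, Fintype.card_fin,
    nsmul_eq_mul] at hsum
  have := mul_le_mul_of_nonneg_left hunion hK
  linarith

/-- Group privacy along a chain of adjacent sequences. -/
theorem IsDP.le_of_chain {T W : ℕ} {adj : IncSeq T W → IncSeq T W → Prop} {ε : ℝ}
    {A : Mechanism T W} (hA : IsDP adj ε A) (𝒢 : ℕ → IncSeq T W) (n : ℕ)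
    (h : ∀ j < n, adj (𝒢 (j + 1)) (𝒢 j)) {S : Set (Fin T → ℝ)} (hS : MeasurableSet S) :
    (A (𝒢 n) : Measure (Fin T → ℝ)) S ≤
      ENNReal.ofReal (Real.exp (ε * n)) * (A (𝒢 0) : Measure (Fin T → ℝ)) S := by
  induction n with
  | zero => simp
  | succ n ih =>
    have hexp : ENNReal.ofReal (Real.exp (ε * (n + 1 : ℕ))) =
        ENNReal.ofReal (Real.exp ε) * ENNReal.ofReal (Real.exp (ε * n)) := by
      rw [← ENNReal.ofReal_mul (Real.exp_pos _).le, ← Real.exp_add]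
      congr 2
      push_cast
      ring
    rw [hexp, mul_assoc]
    exact (hA _ _ (Or.inl (h n n.lt_succ_self)) S hS).trans
      (mul_le_mul_right (ih fun j hj => h j (hj.trans n.lt_succ_self)) _)

/-! ### The hard instances -/

/-- The edges of the complete graph on `{1, …, n}` and the edges from `0` to `1, …, j`. -/
def cliqueStarEdges (n j : ℕ) : Finset (Sym2 ℕ) :=
  -- The loops in `Finset.sym2` are harmless: `uniformGraph` discards them.
  (Finset.Icc 1 n).sym2 ∪ (Finset.Icc 1 j).image fun v => s(0, v)

theorem mk_zero_mem_cliqueStarEdges {n j v : ℕ} :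
    s(0, v) ∈ cliqueStarEdges n j ↔ v ∈ Finset.Icc 1 j := by
  simp only [cliqueStarEdges, Finset.mem_union, Finset.mk_mem_sym2_iff, Finset.mem_image,
    Sym2.congr_right, exists_eq_right, Finset.mem_Icc]
  omega

theorem cliqueStarEdges_succ (n j : ℕ) :
    cliqueStarEdges n (j + 1) = insert s(0, j + 1) (cliqueStarEdges n j) := by
  rw [cliqueStarEdges, cliqueStarEdges, ← Finset.insert_Icc_right_eq_Icc_add_one (by omega),
    Finset.image_insert, Finset.union_insert]

theorem cliqueStarEdges_mono (n : ℕ) {j k : ℕ} (h : j ≤ k) :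
    cliqueStarEdges n j ⊆ cliqueStarEdges n k :=
  Finset.union_subset_union subset_rfl
    (Finset.image_subset_image (Finset.Icc_subset_Icc le_rfl h))

/-- The complete graph on `{1, …, n}` with the node `0` joined to `1, …, j`; all edges have
weight `W`. -/
noncomputable def cliqueStar (W n j : ℕ) : WGraph :=
  uniformGraph W (Finset.range (n + 1)) (cliqueStarEdges n j)

theorem cliqueStar_zero_minCut (W : ℕ) {n : ℕ} (hn : 1 ≤ n) : (cliqueStar W n 0).minCut = 0 := by
  refine WGraph.minCut_eq_zero_of_isolated _ (v := 0) ?_ ?_ fun u => ?_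
  · simp [cliqueStar, uniformGraph]
  · simpa [cliqueStar, uniformGraph] using hn
  · rw [cliqueStar, uniformGraph_weight, if_neg]
    rintro ⟨-, -, h⟩
    rw [mk_zero_mem_cliqueStarEdges] at h
    simp at h

/-- With all `n` star edges present, the graph is complete on `n + 1` nodes. -/
theorem le_cliqueStar_self_minCut (W : ℕ) {n : ℕ} (hn : 1 ≤ n) :
    W * n ≤ (cliqueStar W n n).minCut := by
  refine WGraph.le_minCut_of_complete _ hn (by simp [cliqueStar, uniformGraph]) ?_
  intro u hu v hv huv
  replace hu : u < n + 1 := Finset.mem_range.1 hu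
  replace hv : v < n + 1 := Finset.mem_range.1 hv
  rw [cliqueStar, uniformGraph_weight, if_pos]
  refine ⟨Finset.mk_mem_sym2_iff.2 ⟨Finset.mem_range.2 hu, Finset.mem_range.2 hv⟩, by simpa using huv, ?_⟩
  rcases Nat.eq_zero_or_pos u with rfl | hu₀
  · rw [mk_zero_mem_cliqueStarEdges, Finset.mem_Icc]
    omega
  rcases Nat.eq_zero_or_pos v with rfl | hv₀
  · rw [Sym2.eq_swap, mk_zero_mem_cliqueStarEdges, Finset.mem_Icc]
    omega
  · refine Finset.mem_union_left _ ?_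
    simp only [Finset.mk_mem_sym2_iff, Finset.mem_Icc]
    omega

/-- The sequence in which the first `j` edges at the node `0` are inserted at one time step. -/
noncomputable def cliqueStarSeq (T W n j : ℕ) (i : Fin T) : IncSeq T W :=
  stepSeq (cliqueStar W n 0) (cliqueStar W n j)
    (Finset.Subset.refl (Finset.range (n + 1)))
    (edges_uniformGraph_mono W subset_rfl (cliqueStarEdges_mono n j.zero_le))
    (uniformGraph_weight_le W _ _) (uniformGraph_weight_le W _ _) i

/-- One link of the privacy chain: the extra edge is `s(0, j + 1)`. It is a genuine edge because `j
< n` and `W` is nonzero. -/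
theorem edgeAdj_cliqueStarSeq {T W n j : ℕ} (hW : 1 ≤ W) (hj : j < n) (i : Fin T) :
    EdgeAdj (cliqueStarSeq T W n (j + 1) i) (cliqueStarSeq T W n j i) := by
  refine edgeAdj_stepSeq (e := (s(0, j + 1), W)) rfl ?_ ?_
  · rw [cliqueStar, cliqueStarEdges_succ, edges_uniformGraph_insert hW ?_ (by simp)]
    · rfl
    · simpa using hj
  · rw [cliqueStar, mem_edges_uniformGraph, mk_zero_mem_cliqueStarEdges]
    simp

/-- The complete graph on `{1, …, n + 1}`, to which the isolated node `0` may be added. -/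
noncomputable def cliqueOn (W n : ℕ) (V : Finset ℕ) : WGraph :=
  uniformGraph W V (Finset.Icc 1 (n + 1)).sym2

theorem le_cliqueOn_minCut (W : ℕ) {n : ℕ} (hn : 1 ≤ n) :
    W * n ≤ (cliqueOn W n (Finset.Icc 1 (n + 1))).minCut := by
  refine WGraph.le_minCut_of_complete _ hn (by simp [cliqueOn, uniformGraph]) ?_
  intro u hu v hv huv
  have huv' : s(u, v) ∈ (Finset.Icc 1 (n + 1)).sym2 := Finset.mk_mem_sym2_iff.2 ⟨hu, hv⟩
  rw [cliqueOn, uniformGraph_weight, if_pos ⟨huv', by simpa using huv, huv'⟩]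

theorem cliqueOn_insert_zero_minCut (W n : ℕ) :
    (cliqueOn W n (insert 0 (Finset.Icc 1 (n + 1)))).minCut = 0 := by
  refine WGraph.minCut_eq_zero_of_isolated _ (v := 0) ?_ ?_ fun u => ?_
  · simp [cliqueOn, uniformGraph]
  · simp [cliqueOn, uniformGraph]
  · rw [cliqueOn, uniformGraph_weight, if_neg]
    rintro ⟨-, -, h⟩
    simp at h

theorem cliqueOn_insert_zero_edges (W n : ℕ) :
    (cliqueOn W n (insert 0 (Finset.Icc 1 (n + 1)))).edges =
      (cliqueOn W n (Finset.Icc 1 (n + 1))).edges := by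
  refine Finset.Subset.antisymm (fun p hp => ?_)
    (edges_uniformGraph_mono W (Finset.subset_insert _ _) subset_rfl)
  rw [cliqueOn, mem_edges_uniformGraph] at hp ⊢
  exact ⟨⟨hp.1.2.2, hp.1.2⟩, hp.2⟩

/-! ### Error bounds in terms of the number of adjacency steps -/

theorem EdgeDP.exists_large_error {T W : ℕ} (hW : 1 ≤ W) {ε α β : ℝ} {n : ℕ} (hn : 1 ≤ n)
    {A : Mechanism T W} (hA : EdgeDP ε A) (hT : Real.exp (ε * n) < T * (1 - β))
    (hα : 2 * α ≤ W * n) :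
    ∃ 𝒢 : IncSeq T W, 2 ≤ (𝒢.graph 0).verts.card ∧
      β < (A 𝒢 : Measure (Fin T → ℝ)).real (errorEvent 𝒢 α) := by
  have hTpos : 0 < T := by
    rcases Nat.eq_zero_or_pos T with rfl | h
    · have := Real.exp_pos (ε * n)
      simp at hT
      linarith
    · exact h
  have hmin : 2 * α ≤
      |((cliqueStar W n 0).minCut : ℝ) - ((cliqueStar W n n).minCut : ℝ)| := by
    have h : ((W * n : ℕ) : ℝ) ≤ (cliqueStar W n n).minCut :=
      Nat.cast_le.2 (le_cliqueStar_self_minCut W hn)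
    rw [cliqueStar_zero_minCut W hn, Nat.cast_zero, zero_sub, abs_neg, Nat.abs_cast]
    push_cast at h
    linarith
  obtain ⟨i, hi⟩ := exists_errorEvent_of_packing (α := α) (β := β) A
    (cliqueStarSeq T W n 0 ⟨0, hTpos⟩) (cliqueStarSeq T W n n) (Real.exp_pos (ε * n)).le
    (fun i S hS => by
      -- The chain for each `i` starts at a constant sequence, so all chains share one starting
      -- point.
      have h : cliqueStarSeq T W n 0 ⟨0, hTpos⟩ = cliqueStarSeq T W n 0 i := stepSeq_self _ _ _ _ _
      rw [h]
      exact IsDP.le_of_chain hA (fun j => cliqueStarSeq T W n j i) n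
        (fun j hj => edgeAdj_cliqueStarSeq hW hj i) hS)
    (fun i j hij => exists_minCut_separated hmin hij) hT
  refine ⟨_, ?_, hi⟩
  have h : ((cliqueStarSeq T W n n i).graph 0).verts = Finset.range (n + 1) :=
    congrArg WGraph.verts stepSeq_graph_zero
  rw [h, Finset.card_range]
  omega

/-- A single adjacency step suffices whatever `n` is, so the condition on `T` does not involve `n`.
-/
theorem NodeDP.exists_large_error {T W : ℕ} {ε α β : ℝ} {n : ℕ} (hn : 1 ≤ n)
    {A : Mechanism T W} (hA : NodeDP ε A) (hT : Real.exp ε < T * (1 - β))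
    (hα : 2 * α ≤ W * n) :
    ∃ 𝒢 : IncSeq T W, 2 ≤ (𝒢.graph 0).verts.card ∧
      β < (A 𝒢 : Measure (Fin T → ℝ)).real (errorEvent 𝒢 α) := by
  have hTpos : 0 < T := by
    rcases Nat.eq_zero_or_pos T with rfl | h
    · have := Real.exp_pos ε
      simp at hT
      linarith
    · exact h
  set G := cliqueOn W n (Finset.Icc 1 (n + 1)) with hGdef
  set H := cliqueOn W n (insert 0 (Finset.Icc 1 (n + 1))) with hHdef
  have hmin : 2 * α ≤ |(G.minCut : ℝ) - (H.minCut : ℝ)| := by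
    have h : ((W * n : ℕ) : ℝ) ≤ G.minCut := Nat.cast_le.2 (le_cliqueOn_minCut W hn)
    rw [hHdef, cliqueOn_insert_zero_minCut, Nat.cast_zero, sub_zero, Nat.abs_cast]
    push_cast at h
    linarith
  have hedges : H.edges = G.edges := cliqueOn_insert_zero_edges W n
  have hverts : H.verts = insert 0 G.verts := rfl
  have hG : ∀ e, G.weight e ≤ W := uniformGraph_weight_le W _ _
  have hH : ∀ e, H.weight e ≤ W := uniformGraph_weight_le W _ _
  obtain ⟨i, hi⟩ := exists_errorEvent_of_packing (α := α) (β := β) A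
    (stepSeq G G subset_rfl subset_rfl hG hG ⟨0, hTpos⟩)
    (stepSeq G H (hverts ▸ Finset.subset_insert _ _) hedges.symm.subset hG hH)
    (Real.exp_pos ε).le
    (fun i S hS => by
      rw [stepSeq_self ⟨0, hTpos⟩ i]
      exact hA _ _ (Or.inl (nodeAdj_stepSeq hverts (by simp [hGdef, cliqueOn, uniformGraph])
        hedges)) S hS)
    (fun i j hij => exists_minCut_separated hmin hij) hT
  refine ⟨_, ?_, hi⟩
  rw [stepSeq_graph_zero]
  simpa [hGdef, cliqueOn, uniformGraph] using hn

/-- For large `T` there is an integer `n` of order `log T` such that `e ^ (ε n)` is small compared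
to `T`. -/
theorem exists_threshold {ε : ℝ} (hε : 0 < ε) {β : ℝ} (hβ : β < 1) :
    ∃ T₀ : ℕ, ∀ T : ℕ, T₀ ≤ T → ∃ n : ℕ, 1 ≤ n ∧ Real.exp (ε * n) < T * (1 - β) ∧
      2 * (1 / (8 * ε) * Real.log T) ≤ n := by
  have hlog : Filter.Tendsto (fun T : ℕ => Real.log T) Filter.atTop Filter.atTop :=
    Real.tendsto_log_atTop.comp tendsto_natCast_atTop_atTop
  -- The first bound makes `log T / (4 * ε)` at least `1`; the second says that `√T < T * (1 - β)`.
  obtain ⟨T₀, hT₀⟩ := Filter.eventually_atTop.1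
    ((hlog.eventually_ge_atTop (4 * ε)).and
      ((hlog.eventually_gt_atTop (-2 * Real.log (1 - β))).and
        (Filter.eventually_ge_atTop 1)))
  refine ⟨T₀, fun T hT => ?_⟩
  obtain ⟨h₁, h₂, h₃⟩ := hT₀ T hT
  have hTpos : (0 : ℝ) < T := by exact_mod_cast h₃
  have hβ' : 0 < 1 - β := by linarith
  have hquot : Real.log T / (2 * ε) = 2 * (1 / (8 * ε) * Real.log T) * 2 := by
    field_simp
    norm_num
  have hone : 1 ≤ 2 * (1 / (8 * ε) * Real.log T) := by
    have : 2 * (1 / (8 * ε) * Real.log T) = Real.log T / (4 * ε) := by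
      field_simp
      ring
    rw [this, le_div_iff₀ (by positivity)]
    linarith
  -- With `x = log T / (2 * ε) ≥ 2`, the choice `n = ⌊x⌋₊` satisfies `n > x - 1 ≥ x / 2`, while `exp
  -- (ε * n) ≤ √T`.
  have hfloor := Nat.floor_le (a := Real.log T / (2 * ε)) (by rw [hquot]; linarith)
  have hfloor' := Nat.sub_one_lt_floor (Real.log T / (2 * ε))
  have hle : 2 * (1 / (8 * ε) * Real.log T) ≤ (⌊Real.log T / (2 * ε)⌋₊ : ℝ) := by
    linarith
  refine ⟨⌊Real.log T / (2 * ε)⌋₊, by exact_mod_cast hone.trans hle, ?_, hle⟩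
  rw [← Real.lt_log_iff_exp_lt (by positivity), Real.log_mul hTpos.ne' hβ'.ne']
  rw [le_div_iff₀ (by positivity)] at hfloor
  linarith

end MinCutDP

theorem mainTheorem8 :
    (∀ ε : ℝ, 0 < ε → ∃ c : ℝ, 0 < c ∧
      ∀ β : ℝ, β < 1 → ∃ T₀ : ℕ, ∀ T : ℕ, T₀ ≤ T → ∀ W : ℕ, 1 ≤ W →
        ∀ A : MinCutDP.Mechanism T W, MinCutDP.EdgeDP ε A →
          ∃ 𝒢 : MinCutDP.IncSeq T W, 2 ≤ (𝒢.graph 0).verts.card ∧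
            β < (A 𝒢 : MeasureTheory.Measure (Fin T → ℝ)).real
              (MinCutDP.errorEvent 𝒢 (c * (W * Real.log T)))) ∧
    (∀ ε : ℝ, 0 < ε → ∃ c : ℝ, 0 < c ∧
      ∀ β : ℝ, β < 1 → ∃ T₀ : ℕ, ∀ T : ℕ, T₀ ≤ T → ∀ W : ℕ, 1 ≤ W →
        ∀ A : MinCutDP.Mechanism T W, MinCutDP.NodeDP ε A →
          ∃ 𝒢 : MinCutDP.IncSeq T W, 2 ≤ (𝒢.graph 0).verts.card ∧
            β < (A 𝒢 : MeasureTheory.Measure (Fin T → ℝ)).real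
              (MinCutDP.errorEvent 𝒢 (c * (W * Real.log T)))) := by
  have hscale : ∀ {ε : ℝ} {T W n : ℕ}, 2 * (1 / (8 * ε) * Real.log T) ≤ n →
      2 * (1 / (8 * ε) * (W * Real.log T)) ≤ (W : ℝ) * n := by
    intro ε T W n h
    calc 2 * (1 / (8 * ε) * (W * Real.log T)) = W * (2 * (1 / (8 * ε) * Real.log T)) := by ring
      _ ≤ W * n := mul_le_mul_of_nonneg_left h W.cast_nonneg
  constructor
  -- The error is half of the gap `W * n`, and `n ≥ log T / (4 * ε)`; hence the constant.
  · refine fun ε hε => ⟨1 / (8 * ε), by positivity, fun β hβ => ?_⟩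
    obtain ⟨T₀, hT₀⟩ := MinCutDP.exists_threshold hε hβ
    refine ⟨T₀, fun T hT W hW A hA => ?_⟩
    obtain ⟨n, hn, hexp, hlog⟩ := hT₀ T hT
    exact hA.exists_large_error hW hn hexp (hscale hlog)
  · refine fun ε hε => ⟨1 / (8 * ε), by positivity, fun β hβ => ?_⟩
    obtain ⟨T₀, hT₀⟩ := MinCutDP.exists_threshold hε hβ
    refine ⟨T₀, fun T hT W hW A hA => ?_⟩
    obtain ⟨n, hn, hexp, hlog⟩ := hT₀ T hT
    have hle : Real.exp ε ≤ Real.exp (ε * n) :=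
      Real.exp_le_exp.2 (le_mul_of_one_le_right hε.le (by exact_mod_cast hn))
    exact hA.exists_large_error hn (hle.trans_lt hexp) (hscale hlog)
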